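/- **Binomial extension of the Bressoud–Göllnitz–Gordon identities.** Let $q$ be a complex number with $0<|q|<1$ and write $(a;q)_n=\prod_{i=0}^{n-1}(1-aq^i)$ for integers $n\ge 0$, $(a;q)_\infty=\prod_{i\ge0}(1-aq^i)$ and $(a,b,c;q)_\infty=(a;q)_\infty(b;q)_\infty(c;q)_\infty$. Let $j,r\ge 0$ and $k\ge 1$ be integers with $j+r\le k$. Then \[ \sum_{s_1\ge\cdots\ge s_k\ge0}\frac{q^{2(s_1^2+\cdots+s_k^2+s_{k-r+1}+\cdots+s_k)}\;q^{-2s_1}(q^{2s_1}+q^{-2s_2})\cdots(q^{2s_{j-1}}+q^{-2s_j})\;(-q^{1+2s_k};q^2)_\infty}{(q^2;q^2)_{s_1-s_2}\cdots(q^2;q^2)_{s_{k-1}-s_k}\,(q^2;q^2)_{s_k}} \] \[ =\frac{(-q^3;q^2)_\infty}{(q^2;q^2)_\infty}\sum_{s=0}^{j}\binom{j}{s}\Big((q^{4k+4},q^{2k+3-2r+2j-4s},q^{2k+1+2r-2j+4s};q^{4k+4})_\infty+q\,(q^{4k+4},q^{2k+1-2r+2j-4s},q^{2k+3+2r-2j+4s};q^{4k+4})_\infty\Big),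 \] where the multisum converges absolutely and the weight $q^{-2s_1}(q^{2s_1}+q^{-2s_2})\cdots(q^{2s_{j-1}}+q^{-2s_j})$ is the product of its $j$ displayed factors $q^{-2s_1}$ and $q^{2s_{i-1}}+q^{-2s_i}$ ($2\le i\le j$), so that it is $1$ for $j=0$. Moreover, the same identity holds when this weight is replaced by the product of the elements of any $j$-element subset of $\{q^{-2s_1}\}\cup\{q^{2s_{i-1}}+q^{-2s_i}: 2\le i\le k-r\}$. -/

import Mathlib

/-- The finite q-Pochhammer symbol `(a; q)_n = ∏_{0 ≤ i < n} (1 - a q^i)`. -/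
noncomputable def qPoch (a q : ℂ) (n : ℕ) : ℂ :=
  ∏ i ∈ Finset.range n, (1 - a * q ^ i)

/-- The infinite q-Pochhammer symbol `(a; q)_∞ = ∏_{i ≥ 0} (1 - a q^i)`. -/
noncomputable def qPochInf (a q : ℂ) : ℂ :=
  ∏' i : ℕ, (1 - a * q ^ i)

/-- The infinite product `(a; q)_∞` converges for `|q| < 1`. -/
theorem multipliable_qPochInf (a q : ℂ) (hq : ‖q‖ < 1) :
    Multipliable (fun i : ℕ => 1 - a * q ^ i) := by
  have h : Summable (fun i : ℕ => ‖-(a * q ^ i)‖) := by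
    simp only [norm_neg, norm_mul, norm_pow]
    exact (summable_geometric_of_lt_one (norm_nonneg q) hq).mul_left _
  simpa only [sub_eq_add_neg] using multipliable_one_add_of_summable h

/-- The product `(a, b, c; q)_∞ = (a; q)_∞ (b; q)_∞ (c; q)_∞`. -/
noncomputable def qPochInf3 (a b c q : ℂ) : ℂ :=
  qPochInf a q * qPochInf b q * qPochInf c q

/-- The index set of the multisum: the `k`-tuples of integers `s_1 ≥ ⋯ ≥ s_k ≥ 0`. -/
abbrev DecTuple (k : ℕ) : Type := {s : Fin k → ℕ // Antitone s}

/-- The entry `s_i` of a tuple, with the indices running from `1` to `k`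
(the value `0` outside this range is never used). -/
def DecTuple.entry {k : ℕ} (s : DecTuple k) (i : ℕ) : ℕ :=
  if h : 1 ≤ i ∧ i ≤ k then s.1 ⟨i - 1, by omega⟩ else 0

/-- The available weight factors: the factor with index `1` is `q^(-2 s_1)`, the factor with
index `i ≥ 2` is `q^(2 s_{i-1}) + q^(-2 s_i)`. -/
noncomputable def bggFactor (q : ℂ) {k : ℕ} (s : DecTuple k) (i : ℕ) : ℂ :=
  if i = 1 then q ^ (-2 * (s.entry 1 : ℤ))
  else q ^ (2 * (s.entry (i - 1) : ℤ)) + q ^ (-2 * (s.entry i : ℤ))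

/-- The summand of the multisum, with the product of the weight factors with index in `T`:
`q^(2 (s_1² + ⋯ + s_k² + s_{k-r+1} + ⋯ + s_k)) ∏_{i ∈ T} (factor i) (-q^(1 + 2 s_k); q²)_∞`
divided by `(q²; q²)_{s_1 - s_2} ⋯ (q²; q²)_{s_{k-1} - s_k} (q²; q²)_{s_k}`. -/
noncomputable def bggTerm (q : ℂ) (k r : ℕ) (T : Finset ℕ) (s : DecTuple k) : ℂ :=
  q ^ (2 * (∑ i ∈ Finset.Icc 1 k, s.entry i ^ 2 + ∑ i ∈ Finset.Icc (k - r + 1) k, s.entry i))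
      * (∏ i ∈ T, bggFactor q s i)
      * qPochInf (-q ^ (1 + 2 * s.entry k)) (q ^ 2)
    / ((∏ i ∈ Finset.Icc 1 (k - 1), qPoch (q ^ 2) (q ^ 2) (s.entry i - s.entry (i + 1)))
      * qPoch (q ^ 2) (q ^ 2) (s.entry k))

/-- The product side
`(-q³; q²)_∞ / (q²; q²)_∞ * ∑_{s=0}^{j} C(j, s) *
  ((q^(4k+4), q^(2k+3-2r+2j-4s), q^(2k+1+2r-2j+4s); q^(4k+4))_∞
    + q (q^(4k+4), q^(2k+1-2r+2j-4s), q^(2k+3+2r-2j+4s); q^(4k+4))_∞)`. -/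
noncomputable def bggProductSide (q : ℂ) (k r j : ℕ) : ℂ :=
  qPochInf (-q ^ 3) (q ^ 2) / qPochInf (q ^ 2) (q ^ 2) *
    ∑ s ∈ Finset.range (j + 1), (j.choose s : ℂ) *
      (qPochInf3 (q ^ (4 * k + 4))
          (q ^ (2 * k + 3 - 2 * r + 2 * j - 4 * s : ℤ))
          (q ^ (2 * k + 1 + 2 * r - 2 * j + 4 * s : ℤ)) (q ^ (4 * k + 4))
        + q * qPochInf3 (q ^ (4 * k + 4))
          (q ^ (2 * k + 1 - 2 * r + 2 * j - 4 * s : ℤ))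
          (q ^ (2 * k + 3 + 2 * r - 2 * j + 4 * s : ℤ)) (q ^ (4 * k + 4)))

/-!
Call `(α, β)` a Bailey pair relative to `Q ^ c` if `β n` is the sum over `m` of
`α m / ((Q; Q)_{n - m} (Q; Q)_{n + c + m})`. By the `q`-Chu–Vandermonde sum, summing `β` against
`Q ^ (y² + c y) / (Q; Q)_{n - y}` multiplies `α m` by `Q ^ (m² + c m)`. Inserting the weight factor
`Q ^ n + Q ^ (-y)` mixes the parameters `c = 0` and `c = -1`; for `c = 0` its net effect is a
further factor `Q ^ m + Q ^ (-m)`, whichever summation carries it. Hence the multisum depends only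
on the number of chosen factors.

With `Q = q²`, each summation in the multisum is one such step: relative to `Q` for the last `r`
indices, which carry the linear exponents, and relative to `1` for the others. The same `β` can be
used relative to both parameters because `α (-1 - m) = -Q ^ (2 m + 1) α m`. As `n → ∞` the multisum
becomes a bilateral theta series in `α`; expanding `(Q ^ m + Q ^ (-m)) ^ j` by the binomial theorem
and applying the Jacobi triple product term by term gives the product side.
-/

open Finset Filter Topology

/-! ### `q`-Pochhammer symbols -/

theorem qPoch_zero (a q : ℂ) : qPoch a q 0 = 1 :=
  prod_range_zero _

theorem qPoch_zero_left (q : ℂ) (n : ℕ) : qPoch 0 q n = 1 := by simp [qPoch]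

theorem qPoch_succ (a q : ℂ) (n : ℕ) : qPoch a q (n + 1) = qPoch a q n * (1 - a * q ^ n) :=
  prod_range_succ _ _

theorem qPoch_add (a q : ℂ) (m n : ℕ) :
    qPoch a q (m + n) = qPoch a q m * qPoch (a * q ^ m) q n := by
  simp only [qPoch, prod_range_add, pow_add, mul_assoc]

theorem qPoch_succ' (a q : ℂ) (n : ℕ) : qPoch a q (n + 1) = (1 - a) * qPoch (a * q) q n := by
  rw [add_comm, qPoch_add, qPoch_succ, qPoch_zero]
  simp

theorem one_sub_pow_succ_ne_zero {q : ℂ} (hq : ∀ n, qPoch q q n ≠ 0) (n : ℕ) :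
    1 - q ^ (n + 1) ≠ 0 := by
  have h := hq (n + 1)
  rw [qPoch_succ, ← pow_succ'] at h
  exact right_ne_zero_of_mul h

theorem norm_sq_lt_one {q : ℂ} (hq : ‖q‖ < 1) : ‖q ^ 2‖ < 1 := by
  rw [norm_pow]
  exact pow_lt_one₀ (norm_nonneg q) hq two_ne_zero

theorem summable_norm_mul_pow (a : ℂ) {q : ℂ} (hq : ‖q‖ < 1) :
    Summable fun i : ℕ ↦ ‖-(a * q ^ i)‖ := by
  simp only [norm_neg, norm_mul, norm_pow]
  exact (summable_geometric_of_lt_one (norm_nonneg q) hq).mul_left _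

theorem one_sub_mul_pow_ne_zero {a q : ℂ} (hq : ‖q‖ < 1) (ha : ‖a‖ < 1) (i : ℕ) :
    1 - a * q ^ i ≠ 0 := by
  refine (isUnit_one_sub_of_norm_lt_one ?_).ne_zero
  calc ‖a * q ^ i‖ = ‖a‖ * ‖q‖ ^ i := by rw [norm_mul, norm_pow]
    _ ≤ ‖a‖ := mul_le_of_le_one_right (norm_nonneg a) (pow_le_one₀ (norm_nonneg q) hq.le)
    _ < 1 := ha

theorem qPoch_ne_zero {a q : ℂ} (hq : ‖q‖ < 1) (ha : ‖a‖ < 1) (n : ℕ) : qPoch a q n ≠ 0 :=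
  prod_ne_zero_iff.mpr fun i _ ↦ one_sub_mul_pow_ne_zero hq ha i

theorem qPochInf_ne_zero {a q : ℂ} (hq : ‖q‖ < 1) (ha : ‖a‖ < 1) : qPochInf a q ≠ 0 := by
  simpa only [qPochInf, sub_eq_add_neg] using tprod_one_add_ne_zero_of_summable
    (fun i ↦ by simpa only [sub_eq_add_neg] using one_sub_mul_pow_ne_zero hq ha i)
    (summable_norm_mul_pow a hq)

theorem tendsto_qPoch (a : ℂ) {q : ℂ} (hq : ‖q‖ < 1) :
    Tendsto (qPoch a q) atTop (𝓝 (qPochInf a q)) :=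
  (multipliable_qPochInf a q hq).hasProd.tendsto_prod_nat

theorem qPoch_mul_qPochInf (a : ℂ) {q : ℂ} (hq : ‖q‖ < 1) (n : ℕ) :
    qPoch a q n * qPochInf (a * q ^ n) q = qPochInf a q := by
  refine tendsto_nhds_unique ((tendsto_qPoch _ hq).const_mul _) ?_
  simpa only [← qPoch_add, add_comm n] using
    (tendsto_add_atTop_iff_nat n).mpr (tendsto_qPoch a hq)

/-! ### The `q`-Chu–Vandermonde sum -/

/-- The summand of the `q`-Chu–Vandermonde sum, indexed by `t + u = N`. Writing
`(-x) ^ t * q ^ (t * (t - 1) / 2) * (c / x; q)_t` as the product of the factors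
`q ^ i * (c * q ^ i - x)` keeps `x = 0` admissible. -/
noncomputable def qChuTerm (q c x : ℂ) (t u : ℕ) : ℂ :=
  (∏ i ∈ range t, q ^ i * (c * q ^ i - x)) / (qPoch q q t * qPoch q q u * qPoch c q t)

theorem one_sub_pow_mul_qChuTerm_right {q : ℂ} (hq : ∀ n, qPoch q q n ≠ 0) (c x : ℂ) (t u : ℕ) :
    (1 - q ^ (u + 1)) * qChuTerm q c x t (u + 1) = qChuTerm q c x t u := by
  have hne := one_sub_pow_succ_ne_zero hq u
  rw [qChuTerm, qChuTerm, qPoch_succ q q u, ← pow_succ', ← mul_div_assoc, ← mul_assoc,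
    mul_right_comm _ (1 - _), mul_comm _ (1 - _), mul_div_mul_left _ _ hne]

theorem one_sub_pow_mul_qChuTerm_left {q : ℂ} (hq : ∀ n, qPoch q q n ≠ 0) (c x : ℂ) (t u : ℕ) :
    (1 - q ^ (t + 1)) * qChuTerm q c x (t + 1) u =
      q ^ t * (c - x) / (1 - c) * qChuTerm q (c * q) x t u := by
  have hne := one_sub_pow_succ_ne_zero hq t
  have hprod : ∏ i ∈ range (t + 1), q ^ i * (c * q ^ i - x) =
      q ^ t * (c - x) * ∏ i ∈ range t, q ^ i * (c * q * q ^ i - x) := by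
    simp only [prod_mul_distrib, prod_range_succ' (fun i ↦ c * q ^ i - x),
      prod_range_succ (q ^ ·), pow_zero, mul_one, pow_succ', ← mul_assoc]
    ring
  rw [qChuTerm, qChuTerm, hprod, qPoch_succ q q t, qPoch_succ' c, ← pow_succ', div_mul_div_comm,
    ← mul_div_assoc, ← mul_div_mul_left _ ((1 - c) * _) hne]
  congr 1
  ring

/- Splitting `1 - q ^ (N + 1) = (1 - q ^ u) + q ^ u * (1 - q ^ t)` in the term with `t + u = N + 1`
expresses the sum for `(N + 1, c)` through the sums for `(N, c)` and `(N, c * q)`. -/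
theorem one_sub_pow_mul_sum_qChuTerm {q : ℂ} (hq : ∀ n, qPoch q q n ≠ 0) (c x : ℂ) (N : ℕ) :
    (1 - q ^ (N + 1)) * ∑ p ∈ antidiagonal (N + 1), qChuTerm q c x p.1 p.2 =
      ∑ p ∈ antidiagonal N, qChuTerm q c x p.1 p.2 +
        q ^ N * (c - x) / (1 - c) * ∑ p ∈ antidiagonal N, qChuTerm q (c * q) x p.1 p.2 := by
  calc
    _ = ∑ p ∈ antidiagonal (N + 1), (1 - q ^ p.2) * qChuTerm q c x p.1 p.2 +
        ∑ p ∈ antidiagonal (N + 1), q ^ p.2 * ((1 - q ^ p.1) * qChuTerm q c x p.1 p.2) := by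
      rw [mul_sum, ← sum_add_distrib]
      refine sum_congr rfl fun p hp ↦ ?_
      rw [← mem_antidiagonal.mp hp]
      ring
    _ = _ := by
      rw [Nat.sum_antidiagonal_succ', Nat.sum_antidiagonal_succ, mul_sum]
      simp only [pow_zero, sub_self, zero_mul, mul_zero, zero_add,
        one_sub_pow_mul_qChuTerm_right hq, one_sub_pow_mul_qChuTerm_left hq]
      refine congrArg _ (sum_congr rfl fun p hp ↦ ?_)
      rw [← mem_antidiagonal.mp hp]
      ring

theorem sum_qChuTerm {q c : ℂ} (hq : ∀ n, qPoch q q n ≠ 0) (hc : ∀ n, qPoch c q n ≠ 0)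
    (x : ℂ) (N : ℕ) :
    ∑ p ∈ antidiagonal N, qChuTerm q c x p.1 p.2 =
      qPoch x q N / (qPoch q q N * qPoch c q N) := by
  induction N generalizing c with
  | zero => simp [qChuTerm, qPoch_zero]
  | succ N ih =>
    have hc1 : 1 - c ≠ 0 := by simpa [qPoch_succ, qPoch_zero] using hc 1
    have hcq (n) : qPoch (c * q) q n ≠ 0 := right_ne_zero_of_mul (qPoch_succ' c q n ▸ hc (n + 1))
    have hcN : (1 - c) * qPoch (c * q) q N = qPoch c q N * (1 - c * q ^ N) := by
      rw [← qPoch_succ', qPoch_succ]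
    have hcN0 : 1 - c * q ^ N ≠ 0 := right_ne_zero_of_mul (hcN ▸ mul_ne_zero hc1 (hcq N))
    have hqN0 := one_sub_pow_succ_ne_zero hq N
    refine mul_left_cancel₀ hqN0 ?_
    rw [one_sub_pow_mul_sum_qChuTerm hq, ih hc, ih hcq, qPoch_succ x, qPoch_succ q, qPoch_succ c,
      ← pow_succ', div_mul_div_comm, mul_left_comm (1 - c), hcN]
    have hq' := hq N
    have hc' := hc N
    generalize 1 - q ^ (N + 1) = d at hqN0 ⊢
    generalize he : 1 - c * q ^ N = e at hcN0 ⊢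
    field_simp
    rw [← he]
    ring

/-! ### Bailey kernels -/

/-- The reciprocal `1 / (q; q)_n`, extended by `0` to negative `n`; this encodes the vanishing of
`1 / (q; q)_n` as a quotient of infinite products. -/
noncomputable def invQPoch (q : ℂ) (n : ℤ) : ℂ :=
  if n < 0 then 0 else (qPoch q q n.toNat)⁻¹

theorem invQPoch_of_neg (q : ℂ) {n : ℤ} (hn : n < 0) : invQPoch q n = 0 := if_pos hn

theorem invQPoch_natCast (q : ℂ) (n : ℕ) : invQPoch q n = (qPoch q q n)⁻¹ := by
  simp [invQPoch]

theorem invQPoch_sub_one {q : ℂ} (hq : ∀ n, qPoch q q n ≠ 0) (n : ℤ) :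
    invQPoch q (n - 1) = (1 - q ^ n) * invQPoch q n := by
  rcases lt_trichotomy n 0 with h | rfl | h
  · rw [invQPoch_of_neg q h, invQPoch_of_neg q (by lia), mul_zero]
  · rw [invQPoch_of_neg q (by lia), zpow_zero, sub_self, zero_mul]
  · lift n to ℕ using h.le
    obtain ⟨k, rfl⟩ := Nat.exists_eq_add_one.mpr (by lia : 0 < n)
    rw [Nat.cast_add_one, add_sub_cancel_right, ← Nat.cast_add_one, invQPoch_natCast,
      invQPoch_natCast, qPoch_succ, ← pow_succ', zpow_natCast, mul_inv_rev,
      mul_inv_cancel_left₀ (one_sub_pow_succ_ne_zero hq k)]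

/-- The kernel `1 / ((Q; Q)_{n - m} (Q; Q)_{n + c + m})` of Bailey pairs relative to `Q ^ c`. -/
noncomputable def baileyKernel (Q : ℂ) (c : ℤ) (n : ℕ) (m : ℤ) : ℂ :=
  invQPoch Q (n - m) * invQPoch Q (n + c + m)

theorem baileyKernel_reflect (Q : ℂ) (c : ℤ) (n : ℕ) (m : ℤ) :
    baileyKernel Q c n (-c - m) = baileyKernel Q c n m := by
  rw [baileyKernel, baileyKernel, mul_comm]
  ring_nf

theorem baileyKernel_of_lt (Q : ℂ) (c : ℤ) {n : ℕ} {m : ℤ} (h : n < m) :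
    baileyKernel Q c n m = 0 := by
  rw [baileyKernel, invQPoch_of_neg Q (by lia), zero_mul]

theorem baileyKernel_sub_one {Q : ℂ} (hQ : ∀ n, qPoch Q Q n ≠ 0) (c : ℤ) (n : ℕ) (m : ℤ) :
    baileyKernel Q (c - 1) n m = (1 - Q ^ (n + c + m)) * baileyKernel Q c n m := by
  rw [baileyKernel, baileyKernel, mul_left_comm, ← invQPoch_sub_one hQ]
  ring_nf

theorem baileyKernel_add (Q : ℂ) {c : ℤ} {m M : ℕ} (hM : M = 2 * m + c) (t : ℕ) :
    baileyKernel Q c (m + t) m =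
      (qPoch Q Q t * (qPoch Q Q M * qPoch (Q ^ (M + 1)) Q t))⁻¹ := by
  rw [baileyKernel, mul_inv, ← invQPoch_natCast Q t, pow_succ', ← qPoch_add, ← invQPoch_natCast]
  push_cast
  rw [hM]
  ring_nf

theorem sum_mul_baileyKernel {Q : ℂ} (hQ : ∀ n, qPoch Q Q n ≠ 0) {c : ℤ} {m M : ℕ}
    (hM : M = 2 * m + c) {f : ℕ → ℂ} {x : ℂ}
    (hf : ∀ t, f (m + t + 1) = f (m + t) * (Q ^ t * (Q ^ (M + 1 + t) - x))) (n : ℕ) :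
    ∑ y ∈ range (n + 1), f y * invQPoch Q (n - y) * baileyKernel Q c y m =
      f m * qPoch x Q (n - m) * baileyKernel Q c n m := by
  rcases lt_or_ge n m with hnm | hnm
  · rw [baileyKernel_of_lt Q c (mod_cast hnm), mul_zero]
    refine sum_eq_zero fun y hy ↦ ?_
    rw [mem_range] at hy
    rw [baileyKernel_of_lt Q c (by lia), mul_zero]
  obtain ⟨N, rfl⟩ := Nat.exists_eq_add_of_le hnm
  have hc (n) : qPoch (Q ^ (M + 1)) Q n ≠ 0 := by
    have h := hQ (M + n)
    rw [qPoch_add, ← pow_succ'] at h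
    exact right_ne_zero_of_mul h
  have hfm (t) : f (m + t) = f m * ∏ i ∈ range t, Q ^ i * (Q ^ (M + 1) * Q ^ i - x) := by
    induction t with
    | zero => simp
    | succ t ih => rw [← add_assoc, hf, ih, prod_range_succ, pow_add Q (M + 1), mul_assoc]
  have hterm : ∀ t ∈ range (N + 1),
      f (m + t) * invQPoch Q ((m + N : ℕ) - (m + t : ℕ)) * baileyKernel Q c (m + t) m =
        f m / qPoch Q Q M * qChuTerm Q (Q ^ (M + 1)) x t (N - t) := fun t ht ↦ by
    have htN : ((m + N : ℕ) : ℤ) - (m + t : ℕ) = (N - t : ℕ) := by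
      rw [mem_range] at ht
      lia
    rw [htN, invQPoch_natCast, baileyKernel_add Q hM, hfm, qChuTerm]
    ring
  have hlow : ∀ y ∈ range m,
      f y * invQPoch Q ((m + N : ℕ) - y) * baileyKernel Q c y m = 0 := fun y hy ↦ by
    rw [baileyKernel_of_lt Q c (mod_cast mem_range.mp hy), mul_zero]
  rw [add_assoc, sum_range_add, sum_eq_zero hlow, zero_add, sum_congr rfl hterm, ← mul_sum,
    ← Nat.sum_antidiagonal_eq_sum_range_succ (qChuTerm Q (Q ^ (M + 1)) x), sum_qChuTerm hQ hc,
    baileyKernel_add Q hM, Nat.add_sub_cancel_left]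
  ring

/-- A Bailey pair relative to `Q ^ c`, in bilateral form: reflecting the terms with `m < 0` by
`m ↦ -c - m`, which fixes the kernel, gives the classical one-sided form. -/
def IsBaileyPair (Q : ℂ) (c : ℤ) (α : ℤ → ℂ) (β : ℕ → ℂ) : Prop :=
  ∀ n, HasSum (fun m ↦ α m * baileyKernel Q c n m) (β n)

theorem IsBaileyPair.step {Q : ℂ} {c : ℤ} {α : ℤ → ℂ} {β : ℕ → ℂ} (h : IsBaileyPair Q c α β)
    {g : ℕ → ℕ → ℂ} {μ : ℤ → ℂ}
    (hg : ∀ n m, ∑ y ∈ range (n + 1), g n y * baileyKernel Q c y m = μ m * baileyKernel Q c n m) :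
    IsBaileyPair Q c (fun m ↦ μ m * α m) (fun n ↦ ∑ y ∈ range (n + 1), g n y * β y) := by
  intro n
  refine (hasSum_sum fun y _ ↦ (h y).mul_left (g n y)).congr_fun fun m ↦ ?_
  simp only [mul_left_comm (g n _), ← mul_sum, hg]
  ring

theorem summable_mul_baileyKernel (Q : ℂ) (c : ℤ) (n : ℕ) (α : ℤ → ℂ) :
    Summable fun m ↦ α m * baileyKernel Q c n m := by
  refine summable_of_ne_finset_zero (s := Icc (-(n + c)) n) fun m hm ↦ ?_
  rw [mem_Icc, not_and_or] at hm
  rcases hm with h | h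
  · rw [baileyKernel, invQPoch_of_neg Q (n := n + c + m) (by lia), mul_zero, mul_zero]
  · rw [baileyKernel_of_lt Q c (by lia), mul_zero]

theorem tsum_eq_zero_of_antisymm {ι E : Type*} [AddCommGroup E] [IsAddTorsionFree E]
    [TopologicalSpace E] [IsTopologicalAddGroup E] [T2Space E] {f : ι → E} (e : ι ≃ ι)
    (h : ∀ i, f (e i) = -f i) : ∑' i, f i = 0 := by
  have h1 := e.tsum_eq f
  simp_rw [h, tsum_neg] at h1
  exact self_eq_neg.mp h1.symm

theorem isBaileyPair_zero_iff_one {Q : ℂ} (hQ0 : Q ≠ 0) (hQ : ∀ n, qPoch Q Q n ≠ 0) {α : ℤ → ℂ}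
    (hα : ∀ m, α (-1 - m) = -Q ^ (2 * m + 1) * α m) {β : ℕ → ℂ} :
    IsBaileyPair Q 0 α β ↔ IsBaileyPair Q 1 α β := by
  refine forall_congr' fun n ↦ ?_
  have hdiff (m) : α m * baileyKernel Q 0 n m = α m * baileyKernel Q 1 n m -
      α m * Q ^ (n + 1 + m) * baileyKernel Q 1 n m := by
    rw [← sub_self 1, baileyKernel_sub_one hQ]
    ring
  have hzero : HasSum (fun m ↦ α m * Q ^ (n + 1 + m) * baileyKernel Q 1 n m) 0 := by
    rw [← tsum_eq_zero_of_antisymm (f := fun m ↦ α m * Q ^ (n + 1 + m) * baileyKernel Q 1 n m)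
      (Equiv.subLeft (-1)) fun m ↦ ?_]
    · exact (summable_mul_baileyKernel Q 1 n _).hasSum
    · rw [Equiv.subLeft_apply, baileyKernel_reflect, hα, neg_mul, neg_mul, neg_mul,
        mul_right_comm _ (α m), ← zpow_add₀ hQ0, mul_comm (α m)]
      ring_nf
  rw [funext hdiff]
  exact ⟨fun h ↦ by simpa only [sub_add_cancel, add_zero] using h.add hzero,
    fun h ↦ by simpa only [sub_zero] using h.sub hzero⟩

/-! ### Summation formulas for the kernels -/

theorem sum_zpow_mul_baileyKernel {Q : ℂ} (hQ0 : Q ≠ 0) (hQ : ∀ n, qPoch Q Q n ≠ 0) {c : ℤ}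
    (hc : c ≤ 1) (n : ℕ) (m : ℤ) :
    ∑ y ∈ range (n + 1), Q ^ ((y : ℤ) * (y + c)) * invQPoch Q (n - y) * baileyKernel Q c y m =
      Q ^ (m * (m + c)) * baileyKernel Q c n m := by
  wlog h : 0 ≤ 2 * m + c generalizing m
  · have h' := this (-c - m) (by lia)
    simp only [baileyKernel_reflect] at h'
    rw [h']
    ring_nf
  lift m to ℕ using by lia
  obtain ⟨M, hM⟩ := Int.eq_ofNat_of_zero_le h
  have hf (t : ℕ) : Q ^ (((m + t + 1 : ℕ) : ℤ) * ((m + t + 1 : ℕ) + c)) =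
      Q ^ (((m + t : ℕ) : ℤ) * ((m + t : ℕ) + c)) * (Q ^ t * (Q ^ (M + 1 + t) - 0)) := by
    rw [sub_zero, ← pow_add, ← zpow_natCast, ← zpow_add₀ hQ0]
    push_cast
    rw [← hM]
    ring_nf
  rw [sum_mul_baileyKernel hQ hM.symm hf]
  simp [qPoch_zero_left]

theorem sum_weight_mul_baileyKernel {Q : ℂ} (hQ0 : Q ≠ 0) (hQ : ∀ n, qPoch Q Q n ≠ 0) (n : ℕ)
    (m : ℤ) :
    ∑ y ∈ range (n + 1),
        Q ^ (y ^ 2) * (Q ^ n + (Q ^ y)⁻¹) * invQPoch Q (n - y) * baileyKernel Q 0 y m =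
      Q ^ (m * m) * (Q ^ m + Q ^ (-m)) * baileyKernel Q 0 n m := by
  have hsub (n : ℕ) := baileyKernel_sub_one hQ 0 n m
  simp only [zero_sub, add_zero] at hsub
  have hpow (k : ℤ) : Q ^ (k * (k + -1)) = Q ^ (k * k) / Q ^ k := by
    rw [← zpow_sub₀ hQ0]
    ring_nf
  have hterm (y : ℕ) :
      Q ^ (y ^ 2) * (Q ^ n + (Q ^ y)⁻¹) * invQPoch Q (n - y) * baileyKernel Q 0 y m =
        (Q ^ n + Q ^ m) *
            (Q ^ ((y : ℤ) * (y + 0)) * invQPoch Q (n - y) * baileyKernel Q 0 y m) +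
          Q ^ ((y : ℤ) * (y + -1)) * invQPoch Q (n - y) * baileyKernel Q (-1) y m := by
    have hy : Q ^ y ≠ 0 := pow_ne_zero y hQ0
    rw [hsub, hpow, zpow_add₀ hQ0, add_zero, ← Nat.cast_mul, ← pow_two, zpow_natCast, zpow_natCast]
    field_simp
    ring
  rw [sum_congr rfl fun y _ ↦ hterm y, sum_add_distrib, ← mul_sum,
    sum_zpow_mul_baileyKernel hQ0 hQ zero_le_one,
    sum_zpow_mul_baileyKernel hQ0 hQ (by norm_num), hsub, hpow, zpow_add₀ hQ0 n, add_zero,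
    zpow_natCast, zpow_neg]
  have hm : Q ^ m ≠ 0 := zpow_ne_zero m hQ0
  field_simp
  ring

theorem sum_qPoch_mul_baileyKernel {q : ℂ} (hQ : ∀ n, qPoch (q ^ 2) (q ^ 2) n ≠ 0) (n : ℕ)
    (m : ℤ) :
    ∑ y ∈ range (n + 1), qPoch (-q) (q ^ 2) y * q ^ (y ^ 2) * invQPoch (q ^ 2) (n - y) *
        baileyKernel (q ^ 2) 0 y m =
      q ^ (m ^ 2) * qPoch (-q) (q ^ 2) n * baileyKernel (q ^ 2) 0 n m := by
  wlog h : 0 ≤ m generalizing m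
  · have h' := this (-0 - m) (by lia)
    simp only [baileyKernel_reflect] at h'
    rw [h', neg_zero, zero_sub, neg_sq]
  lift m to ℕ using h
  have hf (t : ℕ) : qPoch (-q) (q ^ 2) (m + t + 1) * q ^ ((m + t + 1) ^ 2) =
      qPoch (-q) (q ^ 2) (m + t) * q ^ ((m + t) ^ 2) *
        ((q ^ 2) ^ t * ((q ^ 2) ^ (2 * m + 1 + t) - -q * (q ^ 2) ^ m)) := by
    rw [qPoch_succ]
    ring
  rw [sum_mul_baileyKernel hQ (by push_cast; ring) hf, ← Nat.cast_pow, zpow_natCast]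
  rcases lt_or_ge n m with hnm | hnm
  · rw [baileyKernel_of_lt _ _ (mod_cast hnm), mul_zero, mul_zero]
  · obtain ⟨N, rfl⟩ := Nat.exists_eq_add_of_le hnm
    rw [Nat.add_sub_cancel_left, qPoch_add]
    ring

/-! ### Limits of Bailey pairs -/

theorem tendsto_invQPoch {q : ℂ} (hq : ‖q‖ < 1) :
    Tendsto (invQPoch q) atTop (𝓝 (qPochInf q q)⁻¹) := by
  have htoNat : Tendsto Int.toNat atTop atTop :=
    tendsto_atTop.mpr fun b ↦
    (eventually_ge_atTop (b : ℤ)).mono fun n hn ↦ by lia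
  refine (((tendsto_qPoch q hq).comp htoNat).inv₀ (qPochInf_ne_zero hq hq)).congr' ?_
  filter_upwards [eventually_ge_atTop 0] with n hn
  rw [invQPoch, if_neg hn.not_gt, Function.comp_apply]

theorem exists_norm_invQPoch_le {q : ℂ} (hq : ‖q‖ < 1) : ∃ C, ∀ n, ‖invQPoch q n‖ ≤ C := by
  obtain ⟨C, hC⟩ := (Metric.isBounded_range_of_tendsto _
    ((tendsto_qPoch q hq).inv₀ (qPochInf_ne_zero hq hq))).exists_norm_le
  refine ⟨C, fun n ↦ ?_⟩
  rw [invQPoch]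
  split_ifs
  · exact norm_zero.trans_le ((norm_nonneg _).trans (hC _ ⟨0, rfl⟩))
  · exact hC _ ⟨n.toNat, rfl⟩

theorem IsBaileyPair.tendsto {Q : ℂ} (hQ : ‖Q‖ < 1) {c : ℤ} {α : ℤ → ℂ} {β : ℕ → ℂ}
    (h : IsBaileyPair Q c α β) (hα : Summable α) :
    Tendsto β atTop (𝓝 ((∑' m, α m) / qPochInf Q Q ^ 2)) := by
  obtain ⟨C, hC⟩ := exists_norm_invQPoch_le hQ
  have hcast := tendsto_natCast_atTop_atTop (R := ℤ)
  rw [funext fun n ↦ (h n).tsum_eq.symm, div_eq_mul_inv, ← inv_pow, pow_two, ← tsum_mul_right]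
  refine tendsto_tsum_of_dominated_convergence (bound := fun m ↦ ‖α m‖ * (C * C))
    (hα.norm.mul_right _) (fun m ↦ ?_) (Eventually.of_forall fun n m ↦ ?_)
  · refine (((tendsto_invQPoch hQ).comp ?_).mul ((tendsto_invQPoch hQ).comp ?_)).const_mul (α m)
    · exact tendsto_atTop_add_const_right _ (-m) hcast
    · exact tendsto_atTop_add_const_right _ m (tendsto_atTop_add_const_right _ c hcast)
  · rw [baileyKernel, norm_mul, norm_mul]
    have := hC (n - m)
    have := hC (n + c + m)
    gcongr
    exact (norm_nonneg _).trans ‹_›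

/-! ### The Jacobi triple product -/

theorem summable_zpow_mul_zpow_sq {z p : ℂ} (hz : z ≠ 0) (hp0 : p ≠ 0) (hp : ‖p‖ < 1) :
    Summable fun m : ℤ ↦ z ^ m * p ^ (m ^ 2) := by
  have hπ : (Real.pi : ℂ) ≠ 0 := mod_cast Real.pi_ne_zero
  have hτ : 0 < (-(Complex.log p * Complex.I) / Real.pi).im := by
    rw [Complex.div_ofReal_im, Complex.neg_im, Complex.mul_I_im, Complex.log_re]
    exact div_pos (neg_pos.mpr (Real.log_neg (norm_pos_iff.mpr hp0) hp)) Real.pi_pos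
  refine ((summable_jacobiTheta₂_term_iff (Complex.log z / (2 * Real.pi * Complex.I)) _).mpr
    hτ).congr fun m ↦ ?_
  have hlin : 2 * Real.pi * Complex.I * m * (Complex.log z / (2 * Real.pi * Complex.I)) =
      m * Complex.log z := by
    field_simp [Complex.I_ne_zero]
  have hquad : Real.pi * Complex.I * m ^ 2 * (-(Complex.log p * Complex.I) / Real.pi) =
      (m ^ 2 : ℤ) * Complex.log p := by
    field_simp
    rw [Complex.I_sq]
    push_cast
    ring
  rw [jacobiTheta₂_term, hlin, hquad, Complex.exp_add, Complex.exp_int_mul, Complex.exp_int_mul,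
    Complex.exp_log hz, Complex.exp_log hp0]

theorem qPoch_mul_zpow_one_sub {z p : ℂ} (hz : z ≠ 0) (hp : p ≠ 0) (n : ℕ) :
    qPoch (z * p ^ (1 - 2 * n : ℤ)) (p ^ 2) n =
      (-z) ^ n * p ^ (-(n : ℤ) ^ 2) * qPoch (p / z) (p ^ 2) n := by
  induction n with
  | zero => simp [qPoch_zero]
  | succ n ih =>
    have hshift : z * p ^ (1 - 2 * (n + 1 : ℕ) : ℤ) * p ^ 2 = z * p ^ (1 - 2 * n : ℤ) := by
      rw [mul_assoc, ← zpow_natCast p 2, ← zpow_add₀ hp]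
      push_cast
      ring_nf
    have hfirst : 1 - z * p ^ (1 - 2 * (n + 1 : ℕ) : ℤ) =
        -z * p ^ (-(2 * n + 1 : ℤ)) * (1 - p / z * (p ^ 2) ^ n) := by
      rw [show (1 - 2 * (n + 1 : ℕ) : ℤ) = -(2 * n + 1 : ℕ) by push_cast; ring,
        show (-(2 * n + 1) : ℤ) = -(2 * n + 1 : ℕ) by push_cast; ring, zpow_neg, zpow_natCast]
      field_simp
      ring
    have hsq : p ^ (-((n + 1 : ℕ) : ℤ) ^ 2) = p ^ (-(2 * n + 1 : ℤ)) * p ^ (-(n : ℤ) ^ 2) := by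
      rw [← zpow_add₀ hp]
      push_cast
      ring_nf
    rw [qPoch_succ', hshift, ih, hfirst, qPoch_succ, hsq]
    ring

theorem qPoch_mul_zpow_one_sub_two_mul {z p : ℂ} (hz : z ≠ 0) (hp : p ≠ 0) (n : ℕ) :
    qPoch (z * p ^ (1 - 2 * n : ℤ)) (p ^ 2) (2 * n) =
      (-z) ^ n * p ^ (-(n : ℤ) ^ 2) * (qPoch (z * p) (p ^ 2) n * qPoch (p / z) (p ^ 2) n) := by
  have hshift : z * p ^ (1 - 2 * n : ℤ) * (p ^ 2) ^ n = z * p := by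
    rw [mul_assoc, ← pow_mul, ← zpow_natCast p, ← zpow_add₀ hp]
    push_cast
    rw [sub_add_cancel, zpow_one]
  rw [two_mul n, qPoch_add, hshift, qPoch_mul_zpow_one_sub hz hp]
  ring

theorem prod_pow_mul_neg_mul_zpow (z : ℂ) {p : ℂ} (hp : p ≠ 0) (n t : ℕ) :
    ∏ i ∈ range t, (p ^ 2) ^ i * (0 * (p ^ 2) ^ i - z * p ^ (1 - 2 * n : ℤ)) =
      (-z) ^ t * p ^ (t * (t - 2 * n) : ℤ) := by
  induction t with
  | zero => simp
  | succ t ih =>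
    have hexp : p ^ ((t + 1 : ℕ) * ((t + 1 : ℕ) - 2 * n) : ℤ) =
        p ^ (t * (t - 2 * n) : ℤ) * p ^ ((2 * t : ℕ) : ℤ) * p ^ (1 - 2 * n : ℤ) := by
      rw [← zpow_add₀ hp, ← zpow_add₀ hp]
      push_cast
      ring_nf
    rw [prod_range_succ, ih, hexp, zpow_natCast, pow_mul, pow_succ]
    ring

theorem theta_mul_baileyKernel_eq_qChuTerm {z p : ℂ} (hz : z ≠ 0) (hp : p ≠ 0) {n t : ℕ}
    (ht : t ≤ 2 * n) :
    (-z) ^ (t - n : ℤ) * p ^ ((t - n : ℤ) ^ 2) * baileyKernel (p ^ 2) 0 n (t - n) =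
      (-z) ^ (-n : ℤ) * p ^ ((n : ℤ) ^ 2) *
        qChuTerm (p ^ 2) 0 (z * p ^ (1 - 2 * n : ℤ)) t (2 * n - t) := by
  have hexp : p ^ (t - n : ℤ) ^ 2 = p ^ (n : ℤ) ^ 2 * p ^ (t * (t - 2 * n) : ℤ) := by
    rw [← zpow_add₀ hp]
    ring_nf
  have hzt : (-z) ^ (t - n : ℤ) = (-z) ^ (-n : ℤ) * (-z) ^ t := by
    rw [← zpow_natCast, ← zpow_add₀ (neg_ne_zero.mpr hz), neg_add_eq_sub]
  rw [qChuTerm, prod_pow_mul_neg_mul_zpow z hp, baileyKernel, hexp, hzt, qPoch_zero_left,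
    show (n - (t - n) : ℤ) = (2 * n - t : ℕ) by lia, show (n + 0 + (t - n) : ℤ) = t by ring,
    invQPoch_natCast, invQPoch_natCast]
  ring

/- After the shift `m = t - n`, the theta series against the kernel is the Chu–Vandermonde sum of
degree `2 n` with lower parameter `0`: a finite form of the triple product. -/
theorem isBaileyPair_theta {z p : ℂ} (hz : z ≠ 0) (hp : p ≠ 0)
    (hP : ∀ n, qPoch (p ^ 2) (p ^ 2) n ≠ 0) :
    IsBaileyPair (p ^ 2) 0 (fun m ↦ (-z) ^ m * p ^ (m ^ 2)) fun n ↦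
      qPoch (z * p) (p ^ 2) n * qPoch (p / z) (p ^ 2) n / qPoch (p ^ 2) (p ^ 2) (2 * n) := by
  intro n
  set f : ℤ → ℂ := fun m ↦ (-z) ^ m * p ^ (m ^ 2) * baileyKernel (p ^ 2) 0 n m with hf
  have hinj : Function.Injective fun t : ℕ ↦ (t : ℤ) - n :=
    sub_left_injective.comp Nat.cast_injective
  have hterm : ∀ t ∈ range (2 * n + 1), f (t - n) = (-z) ^ (-n : ℤ) * p ^ ((n : ℤ) ^ 2) *
      qChuTerm (p ^ 2) 0 (z * p ^ (1 - 2 * n : ℤ)) t (2 * n - t) :=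
    fun t ht ↦ theta_mul_baileyKernel_eq_qChuTerm hz hp (Nat.lt_succ_iff.mp (mem_range.mp ht))
  have hsum : ∑ t ∈ range (2 * n + 1), f (t - n) =
      qPoch (z * p) (p ^ 2) n * qPoch (p / z) (p ^ 2) n / qPoch (p ^ 2) (p ^ 2) (2 * n) := by
    have hpn := zpow_ne_zero ((n : ℤ) ^ 2) hp
    have hzn := pow_ne_zero n (neg_ne_zero.mpr hz)
    rw [sum_congr rfl hterm, ← mul_sum,
      ← Nat.sum_antidiagonal_eq_sum_range_succ (qChuTerm (p ^ 2) 0 _),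
      sum_qChuTerm hP (fun n ↦ by simp [qPoch_zero_left]),
      qPoch_mul_zpow_one_sub_two_mul hz hp, qPoch_zero_left, mul_one, zpow_neg, zpow_neg,
      zpow_natCast]
    field_simp
  have hsupp : ∀ t ∉ range (2 * n + 1), (f ∘ fun t : ℕ ↦ (t : ℤ) - n) t = 0 := fun t ht ↦ by
    rw [mem_range] at ht
    simp only [hf, Function.comp_apply]
    rw [baileyKernel_of_lt _ _ (by lia), mul_zero]
  beta_reduce
  rw [← hsum, ← hinj.hasSum_iff fun m hm ↦ ?_]
  · exact hasSum_sum_of_ne_finset_zero hsupp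
  · have hneg : n + 0 + m < 0 := by
      by_contra! h
      exact hm ⟨(n + m).toNat, by lia⟩
    simp only [hf]
    rw [baileyKernel, invQPoch_of_neg _ hneg, mul_zero, mul_zero]

theorem hasSum_jacobiTripleProduct {z p : ℂ} (hz : z ≠ 0) (hp0 : p ≠ 0) (hp : ‖p‖ < 1) :
    HasSum (fun m : ℤ ↦ (-z) ^ m * p ^ (m ^ 2)) (qPochInf3 (p ^ 2) (z * p) (p / z) (p ^ 2)) := by
  have hP := norm_sq_lt_one hp
  have hsum := summable_zpow_mul_zpow_sq (neg_ne_zero.mpr hz) hp0 hp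
  have hdouble : Tendsto (2 * ·) atTop (atTop : Filter ℕ) :=
    tendsto_id.const_mul_atTop' two_pos
  have hlim := (((tendsto_qPoch (z * p) hP).mul (tendsto_qPoch (p / z) hP)).div
    ((tendsto_qPoch (p ^ 2) hP).comp hdouble) (qPochInf_ne_zero hP hP))
  have heq := tendsto_nhds_unique
    ((isBaileyPair_theta hz hp0 (qPoch_ne_zero hP hP)).tendsto hP hsum) hlim
  have h0 := qPochInf_ne_zero hP hP
  convert hsum.hasSum using 1
  rw [qPochInf3]
  field_simp at heq
  linear_combination -heq

/-! ### The initial Bailey pair -/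

theorem isBaileyPair_invQPoch_mul_inv_qPoch {q : ℂ} (hq0 : q ≠ 0) (hq : ‖q‖ < 1) :
    IsBaileyPair (q ^ 2) 0 (fun m ↦ (-1) ^ m * q ^ (2 * m ^ 2 - m))
      fun n ↦ invQPoch (q ^ 2) n * (qPoch (-q) (q ^ 2) n)⁻¹ := by
  have hQ := norm_sq_lt_one hq
  have hpair := (isBaileyPair_theta (inv_ne_zero hq0) hq0 (qPoch_ne_zero hQ hQ)).step
    (g := fun n y ↦ (qPoch (-q) (q ^ 2) n)⁻¹ *
      (qPoch (-q) (q ^ 2) y * q ^ (y ^ 2) * invQPoch (q ^ 2) (n - y)))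
    (μ := fun m ↦ q ^ (m ^ 2)) fun n m ↦ by
      simp only [mul_assoc (qPoch (-q) (q ^ 2) n)⁻¹, ← mul_sum]
      have hne := qPoch_ne_zero hQ ((norm_neg q).trans_lt hq) n
      rw [sum_qPoch_mul_baileyKernel (qPoch_ne_zero hQ hQ)]
      field_simp
  convert hpair using 2 with m n
  · rw [neg_eq_neg_one_mul q⁻¹, mul_zpow, inv_zpow', mul_left_comm, mul_assoc,
      ← zpow_add₀ hq0, ← zpow_add₀ hq0]
    ring_nf
  · rw [sum_eq_single_of_mem 0 (by simp) fun y _ hy ↦ ?_]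
    · simp [qPoch_zero, mul_comm]
    · obtain ⟨y, rfl⟩ := Nat.exists_eq_succ_of_ne_zero hy
      rw [inv_mul_cancel₀ hq0, qPoch_succ' 1, sub_self, zero_mul, zero_mul, zero_div, mul_zero]

/-- The sequence `α` of the Bailey pair relative to `1` that generates the identities: the Bailey
pair with `β = 1 / ((q ^ 2; q ^ 2)_n (-q; q ^ 2)_n)` plus `q` times its reflection, which makes `α`
antisymmetric in the sense of `isBaileyPair_zero_iff_one`. -/
noncomputable def initialAlpha (q : ℂ) (m : ℤ) : ℂ :=
  (-1) ^ m * (q ^ (2 * m ^ 2 - m) + q ^ (2 * m ^ 2 + m + 1))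

/-- The sequence `β` paired with `initialAlpha`. -/
noncomputable def initialBeta (q : ℂ) (n : ℕ) : ℂ :=
  (1 + q) * (invQPoch (q ^ 2) n * (qPoch (-q) (q ^ 2) n)⁻¹)

theorem isBaileyPair_initial {q : ℂ} (hq0 : q ≠ 0) (hq : ‖q‖ < 1) :
    IsBaileyPair (q ^ 2) 0 (initialAlpha q) (initialBeta q) := by
  intro n
  have hhalf := isBaileyPair_invQPoch_mul_inv_qPoch hq0 hq n
  have hreflect := ((Equiv.neg ℤ).hasSum_iff.mpr hhalf).mul_left q
  rw [initialBeta, one_add_mul]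
  refine (hhalf.add hreflect).congr_fun fun m ↦ ?_
  have hkernel := baileyKernel_reflect (q ^ 2) 0 n m
  rw [neg_zero, zero_sub] at hkernel
  simp only [Function.comp_apply, Equiv.neg_apply, initialAlpha, neg_sq, sub_neg_eq_add, hkernel]
  rw [zpow_neg, ← inv_zpow, inv_neg, inv_one, zpow_add_one₀ hq0]
  ring

theorem initialAlpha_antisymm {q : ℂ} (hq0 : q ≠ 0) (m : ℤ) :
    initialAlpha q (-1 - m) = -(q ^ 2) ^ (2 * m + 1) * initialAlpha q m := by
  have hsign : (-1 : ℂ) ^ (-1 - m) = -(-1) ^ m := by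
    rw [sub_eq_add_neg, zpow_add₀ (by norm_num), zpow_neg _ m, ← inv_zpow, inv_neg, inv_one]
    simp
  have hsq : (q ^ 2) ^ (2 * m + 1) = q ^ (4 * m + 2) := by
    rw [← zpow_natCast q 2, ← zpow_mul]
    ring_nf
  rw [initialAlpha, initialAlpha, hsign, hsq, neg_mul, neg_mul,
    mul_left_comm (q ^ _), mul_add (q ^ _), ← zpow_add₀ hq0, ← zpow_add₀ hq0]
  ring_nf

theorem exists_norm_initialBeta_le {q : ℂ} (hq : ‖q‖ < 1) : ∃ C, ∀ n, ‖initialBeta q n‖ ≤ C := by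
  have hQ := norm_sq_lt_one hq
  have hlim := (((tendsto_invQPoch hQ).comp tendsto_natCast_atTop_atTop).mul
    ((tendsto_qPoch (-q) hQ).inv₀ (qPochInf_ne_zero hQ ((norm_neg q).trans_lt hq)))).const_mul
      (1 + q)
  obtain ⟨C, hC⟩ := (Metric.isBounded_range_of_tendsto _ hlim).exists_norm_le
  exact ⟨C, fun n ↦ hC _ ⟨n, rfl⟩⟩

/-! ### Multisums along paths -/

/-- The product of the weights `g i (s i) (s (i + 1))` along the path `s`, times the weight `β` of
its last entry. -/
noncomputable def pathTerm {k : ℕ} (g : ℕ → ℕ → ℕ → ℂ) (β : ℕ → ℂ) (s : Fin (k + 1) → ℕ) : ℂ :=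
  (∏ i : Fin k, g i (s i.castSucc) (s i.succ)) * β (s (Fin.last k))

/-- The sum of `pathTerm g β` over the nonincreasing paths with `k` steps that start at `n`. -/
noncomputable def pathSum : ℕ → (ℕ → ℕ → ℕ → ℂ) → (ℕ → ℂ) → ℕ → ℂ
  | 0, _, β, n => β n
  | k + 1, g, β, n => ∑ y ∈ range (n + 1), g 0 n y * pathSum k (fun i ↦ g (i + 1)) β y

theorem pathSum_add (d r : ℕ) (g : ℕ → ℕ → ℕ → ℂ) (β : ℕ → ℂ) :
    pathSum (d + r) g β = pathSum d g (pathSum r (fun i ↦ g (d + i)) β) := by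
  induction d generalizing g with
  | zero => simp only [zero_add, pathSum]
  | succ d ih =>
    funext n
    rw [Nat.add_right_comm, pathSum, pathSum, ih]
    simp only [Nat.add_right_comm]

theorem IsBaileyPair.iterate {Q : ℂ} {c : ℤ} {α : ℤ → ℂ} {β : ℕ → ℂ} (h : IsBaileyPair Q c α β)
    {k : ℕ} {g : ℕ → ℕ → ℕ → ℂ} {μ : ℕ → ℤ → ℂ}
    (hg : ∀ i < k, ∀ n m, ∑ y ∈ range (n + 1), g i n y * baileyKernel Q c y m =
      μ i m * baileyKernel Q c n m) :
    IsBaileyPair Q c (fun m ↦ (∏ i ∈ range k, μ i m) * α m) (pathSum k g β) := by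
  induction k generalizing g μ with
  | zero => simpa [pathSum] using h
  | succ k ih =>
    have hstep := (ih fun i hi ↦ hg (i + 1) (by lia)).step (hg 0 k.succ_pos)
    simp only [prod_range_succ', mul_comm _ (μ 0 _), mul_assoc]
    exact hstep

theorem pathTerm_cons {k : ℕ} (g : ℕ → ℕ → ℕ → ℂ) (β : ℕ → ℂ) (n : ℕ) (s : Fin (k + 1) → ℕ) :
    pathTerm g β (Fin.cons n s : Fin (k + 2) → ℕ) =
      g 0 n (s 0) * pathTerm (fun i ↦ g (i + 1)) β s := by
  rw [pathTerm, pathTerm, Fin.prod_univ_succ, ← Fin.succ_last, Fin.cons_succ, mul_assoc]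
  simp only [Fin.castSucc_zero, Fin.cons_zero, Fin.cons_succ, Fin.val_zero, Fin.val_succ,
    ← Fin.succ_castSucc]

theorem pathTerm_eq_zero_of_not_antitone {k : ℕ} {g : ℕ → ℕ → ℕ → ℂ}
    (hg : ∀ i x y, x < y → g i x y = 0) (β : ℕ → ℂ) {s : Fin (k + 1) → ℕ} (hs : ¬ Antitone s) :
    pathTerm g β s = 0 := by
  rw [Fin.antitone_iff_succ_le] at hs
  push Not at hs
  obtain ⟨i, hi⟩ := hs
  rw [pathTerm, prod_eq_zero (mem_univ i) (hg _ _ _ hi), zero_mul]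

theorem summable_prod_fin {ι : Type*} {b : ι → ℝ} (hb0 : ∀ n, 0 ≤ b n) (hb : Summable b) (k : ℕ) :
    Summable fun s : Fin k → ι ↦ ∏ i, b (s i) := by
  induction k with
  | zero => exact (hasSum_fintype _).summable
  | succ k ih =>
    rw [← (Fin.consEquiv fun _ ↦ ι).summable_iff]
    refine (hb.mul_of_nonneg ih hb0 fun s ↦ prod_nonneg fun i _ ↦ hb0 _).congr fun x ↦ ?_
    exact (Fin.prod_univ_succ fun i ↦ b (Fin.consEquiv (fun _ ↦ ι) x i)).symm

section Convergence

variable {g : ℕ → ℕ → ℕ → ℂ} {β : ℕ → ℂ} {b : ℕ → ℝ} {C : ℝ}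

theorem norm_pathTerm_cons_le {k : ℕ} (hgb : ∀ i x y, ‖g i x y‖ ≤ b y) (hβ : ∀ n, ‖β n‖ ≤ C)
    (n : ℕ) (s : Fin k → ℕ) :
    ‖pathTerm g β (Fin.cons n s : Fin (k + 1) → ℕ)‖ ≤ (∏ i, b (s i)) * C := by
  rw [pathTerm, norm_mul, norm_prod]
  refine mul_le_mul (prod_le_prod (fun _ _ ↦ norm_nonneg _) fun i _ ↦ ?_) (hβ _)
    (norm_nonneg _) (prod_nonneg fun i _ ↦ (norm_nonneg _).trans (hgb 0 0 _))
  exact (hgb _ _ _).trans_eq (by rw [Fin.cons_succ])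

theorem hasSum_pathTerm_cons (hg : ∀ i x y, x < y → g i x y = 0)
    (hgb : ∀ i x y, ‖g i x y‖ ≤ b y) (hb : Summable b) (hβ : ∀ n, ‖β n‖ ≤ C) (k n : ℕ) :
    HasSum (fun s : Fin k → ℕ ↦ pathTerm g β (Fin.cons n s : Fin (k + 1) → ℕ))
      (pathSum k g β n) := by
  induction k generalizing g n with
  | zero => simp [pathSum, pathTerm]
  | succ k ih =>
    have hcons : (fun s : Fin (k + 1) → ℕ ↦ pathTerm g β (Fin.cons n s : Fin (k + 2) → ℕ)) ∘
        Fin.consEquiv (fun _ ↦ ℕ) = fun p : ℕ × (Fin k → ℕ) ↦ g 0 n p.1 *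
          pathTerm (fun i ↦ g (i + 1)) β (Fin.cons p.1 p.2 : Fin (k + 1) → ℕ) :=
      funext fun p ↦ pathTerm_cons g β n _
    have hsum := Summable.of_norm_bounded
      ((summable_prod_fin (fun y ↦ (norm_nonneg _).trans (hgb 0 0 y)) hb (k + 1)).mul_right C)
      (norm_pathTerm_cons_le hgb hβ n)
    rw [← (Fin.consEquiv fun _ ↦ ℕ).summable_iff, hcons] at hsum
    have hfiber (y : ℕ) :=
      (ih (fun i ↦ hg (i + 1)) (fun i ↦ hgb (i + 1)) y).mul_left (g 0 n y)
    have htotal := (hasSum_sum_of_ne_finset_zero (s := range (n + 1)) fun y hy ↦ by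
      rw [hg 0 n y (by simpa using hy), zero_mul]).unique (hsum.hasSum.prod_fiberwise hfiber)
    rw [← (Fin.consEquiv fun _ ↦ ℕ).hasSum_iff, hcons, pathSum, htotal]
    exact hsum.hasSum

theorem hasSum_pathTerm_of_tendsto (hg : ∀ i x y, x < y → g i x y = 0)
    (hgb : ∀ i x y, ‖g i x y‖ ≤ b y) (hb : Summable b) (hβ : ∀ n, ‖β n‖ ≤ C) {G : ℕ → ℂ}
    (hG : ∀ y, Tendsto (fun n ↦ g 0 n y) atTop (𝓝 (G y))) {k : ℕ} {L : ℂ}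
    (hL : Tendsto (pathSum (k + 1) g β) atTop (𝓝 L)) :
    HasSum (fun s : Fin (k + 1) → ℕ ↦ G (s 0) * pathTerm (fun i ↦ g (i + 1)) β s) L := by
  have hbound :=
    (summable_prod_fin (fun y ↦ (norm_nonneg _).trans (hgb 0 0 y)) hb (k + 1)).mul_right C
  have hterm (s : Fin (k + 1) → ℕ) :
      Tendsto (fun n ↦ pathTerm g β (Fin.cons n s : Fin (k + 2) → ℕ)) atTop
        (𝓝 (G (s 0) * pathTerm (fun i ↦ g (i + 1)) β s)) := by
    simp only [pathTerm_cons]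
    exact (hG _).mul_const _
  have hsum := Summable.of_norm_bounded hbound fun s ↦ le_of_tendsto (hterm s).norm
    (Eventually.of_forall fun n ↦ norm_pathTerm_cons_le hgb hβ n s)
  have hlim := tendsto_tsum_of_dominated_convergence hbound hterm
    (Eventually.of_forall fun n s ↦ norm_pathTerm_cons_le hgb hβ n s)
  simp only [(hasSum_pathTerm_cons hg hgb hb hβ (k + 1) _).tsum_eq] at hlim
  rw [tendsto_nhds_unique hL hlim]
  exact hsum.hasSum

end Convergence

/-! ### The kernels of the multisum -/

/-- The weight of the step from `x = s_i` to `y = s_{i + 1}` in the multisum with base `Q`. The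
linear exponent is present from the step `d = k - r` on, and `T` is the set of the indices `i + 1`
of the chosen weight factors. -/
noncomputable def bggKernel (Q : ℂ) (d : ℕ) (T : Finset ℕ) (i x y : ℕ) : ℂ :=
  Q ^ (y ^ 2) * (if i < d then 1 else Q ^ y) * (if i + 1 ∈ T then Q ^ x + (Q ^ y)⁻¹ else 1) *
    invQPoch Q (x - y)

/-- The limit of `bggKernel Q d T 0 x y` as `x` tends to infinity. -/
noncomputable def bggKernelLim (Q : ℂ) (d : ℕ) (T : Finset ℕ) (y : ℕ) : ℂ :=
  Q ^ (y ^ 2) * (if 0 < d then 1 else Q ^ y) * (if 1 ∈ T then (Q ^ y)⁻¹ else 1) *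
    (qPochInf Q Q)⁻¹

theorem tendsto_bggKernel {Q : ℂ} (hQ : ‖Q‖ < 1) (d : ℕ) (T : Finset ℕ) (y : ℕ) :
    Tendsto (fun n ↦ bggKernel Q d T 0 n y) atTop (𝓝 (bggKernelLim Q d T y)) := by
  refine Tendsto.mul (Tendsto.const_mul _ ?_) ?_
  · rw [zero_add]
    split_ifs
    · simpa using (tendsto_pow_atTop_nhds_zero_of_norm_lt_one hQ).add_const (Q ^ y)⁻¹
    · exact tendsto_const_nhds
  · exact (tendsto_invQPoch hQ).comp
      (tendsto_atTop_add_const_right _ (-(y : ℤ)) tendsto_natCast_atTop_atTop)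

theorem bggKernel_of_lt (Q : ℂ) (d : ℕ) (T : Finset ℕ) (i : ℕ) {x y : ℕ} (h : x < y) :
    bggKernel Q d T i x y = 0 := by
  rw [bggKernel, invQPoch_of_neg Q (by lia), mul_zero]

theorem exists_summable_norm_bggKernel_le {Q : ℂ} (hQ0 : Q ≠ 0) (hQ : ‖Q‖ < 1) (d : ℕ)
    (T : Finset ℕ) : ∃ b : ℕ → ℝ, Summable b ∧ ∀ i x y, ‖bggKernel Q d T i x y‖ ≤ b y := by
  obtain ⟨C, hC⟩ := exists_norm_invQPoch_le hQ
  have htheta := (summable_zpow_mul_zpow_sq (inv_ne_zero hQ0) hQ0 hQ).norm.comp_injective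
    (Nat.cast_injective (R := ℤ))
  refine ⟨_, htheta.mul_right (2 * C), fun i x y ↦ ?_⟩
  have hpow (n : ℕ) : ‖Q ^ n‖ ≤ 1 := (norm_pow Q n).trans_le (pow_le_one₀ (norm_nonneg Q) hQ.le)
  have hinv : 1 ≤ ‖(Q ^ y)⁻¹‖ := by
    rw [norm_inv]
    exact (one_le_inv₀ (norm_pos_iff.mpr (pow_ne_zero y hQ0))).mpr (hpow y)
  have hlin : ‖if i < d then 1 else Q ^ y‖ ≤ 1 := by
    split_ifs
    · exact norm_one.le
    · exact hpow y
  have hweight : ‖if i + 1 ∈ T then Q ^ x + (Q ^ y)⁻¹ else 1‖ ≤ 2 * ‖(Q ^ y)⁻¹‖ := by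
    split_ifs
    · linarith [norm_add_le (Q ^ x) (Q ^ y)⁻¹, hpow x]
    · rw [norm_one]
      linarith
  calc ‖bggKernel Q d T i x y‖
      = ‖Q ^ (y ^ 2)‖ * ‖if i < d then 1 else Q ^ y‖ *
          ‖if i + 1 ∈ T then Q ^ x + (Q ^ y)⁻¹ else 1‖ * ‖invQPoch Q (x - y)‖ := by
        rw [bggKernel, norm_mul, norm_mul, norm_mul]
    _ ≤ ‖Q ^ (y ^ 2)‖ * 1 * (2 * ‖(Q ^ y)⁻¹‖) * C := by
        gcongr
        exact hC _
    _ = ‖Q⁻¹ ^ (y : ℤ) * Q ^ ((y : ℤ) ^ 2)‖ * (2 * C) := by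
        rw [← Nat.cast_pow, zpow_natCast, zpow_natCast, inv_pow, norm_mul]
        ring

theorem sum_bggKernel_mul_baileyKernel_zero {Q : ℂ} (hQ0 : Q ≠ 0) (hQ : ∀ n, qPoch Q Q n ≠ 0)
    {d i : ℕ} (hi : i < d) (T : Finset ℕ) (n : ℕ) (m : ℤ) :
    ∑ y ∈ range (n + 1), bggKernel Q d T i n y * baileyKernel Q 0 y m =
      Q ^ (m * m) * (if i + 1 ∈ T then Q ^ m + Q ^ (-m) else 1) * baileyKernel Q 0 n m := by
  by_cases hT : i + 1 ∈ T
  · simp only [bggKernel, if_pos hi, if_pos hT, mul_one, sum_weight_mul_baileyKernel hQ0 hQ]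
  · have h := sum_zpow_mul_baileyKernel hQ0 hQ zero_le_one n m
    simp only [add_zero, ← sq, ← Nat.cast_pow, zpow_natCast] at h
    simp only [bggKernel, if_pos hi, if_neg hT, mul_one, h, ← sq]

theorem sum_bggKernel_mul_baileyKernel_one {Q : ℂ} (hQ0 : Q ≠ 0) (hQ : ∀ n, qPoch Q Q n ≠ 0)
    {d i : ℕ} (hi : d ≤ i) {T : Finset ℕ} (hT : T ⊆ Icc 1 d) (n : ℕ) (m : ℤ) :
    ∑ y ∈ range (n + 1), bggKernel Q d T i n y * baileyKernel Q 1 y m =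
      Q ^ (m * (m + 1)) * baileyKernel Q 1 n m := by
  have hiT : i + 1 ∉ T := fun h ↦ by
    have := mem_Icc.mp (hT h)
    lia
  rw [← sum_zpow_mul_baileyKernel hQ0 hQ le_rfl]
  refine sum_congr rfl fun y _ ↦ ?_
  rw [bggKernel, if_neg hi.not_gt, if_neg hiT, mul_one, mul_add, mul_one, zpow_add₀ hQ0,
    zpow_natCast, ← sq, ← Nat.cast_pow, zpow_natCast]

theorem prod_Icc_one {M : Type*} [CommMonoid M] (f : ℕ → M) (k : ℕ) :
    ∏ i ∈ Icc 1 k, f i = ∏ i ∈ range k, f (i + 1) := by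
  rw [← Ico_add_one_right_eq_Icc, prod_Ico_eq_prod_range]
  simp only [Nat.add_sub_cancel, add_comm 1]

theorem prod_range_ite_mem {M : Type*} [CommMonoid M] {T : Finset ℕ} {k : ℕ} (hT : T ⊆ Icc 1 k)
    (f : ℕ → M) : ∏ i ∈ range k, (if i + 1 ∈ T then f (i + 1) else 1) = ∏ i ∈ T, f i := by
  rw [← prod_Icc_one fun i ↦ if i ∈ T then f i else 1, prod_ite_mem, inter_eq_right.mpr hT]

/- The last `r` steps are taken relative to `Q`, the others relative to `1`: antisymmetry, which the
steps relative to `Q` preserve, allows the change of parameter on both sides. -/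
theorem isBaileyPair_pathSum_bggKernel {Q : ℂ} (hQ0 : Q ≠ 0) (hQ : ∀ n, qPoch Q Q n ≠ 0)
    {α : ℤ → ℂ} {β : ℕ → ℂ} (h : IsBaileyPair Q 0 α β)
    (hα : ∀ m, α (-1 - m) = -Q ^ (2 * m + 1) * α m) {d : ℕ} {T : Finset ℕ} (hT : T ⊆ Icc 1 d)
    (r : ℕ) :
    IsBaileyPair Q 0
      (fun m ↦ (Q ^ (m * m)) ^ d * (Q ^ m + Q ^ (-m)) ^ #T * ((Q ^ (m * (m + 1))) ^ r * α m))
      (pathSum (d + r) (bggKernel Q d T) β) := by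
  have hinner := ((isBaileyPair_zero_iff_one hQ0 hQ hα).mp h).iterate (k := r) fun i _ ↦
    sum_bggKernel_mul_baileyKernel_one hQ0 hQ (Nat.le_add_right d i) hT
  simp only [prod_const, card_range] at hinner
  have houter := ((isBaileyPair_zero_iff_one hQ0 hQ fun m ↦ by
    rw [hα, show (-1 - m) * (-1 - m + 1) = m * (m + 1) by ring]
    ring).mpr hinner).iterate (k := d) fun i hi ↦
    sum_bggKernel_mul_baileyKernel_zero hQ0 hQ hi T
  rw [pathSum_add]
  convert houter using 3 with m
  rw [prod_mul_distrib, prod_const, card_range, prod_range_ite_mem hT fun _ ↦ Q ^ m + Q ^ (-m),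
    prod_const]

/-! ### The multisum side -/

/-- The factor `q ^ (2 (s_1² + ⋯ + s_k² + s_{k-r+1} + ⋯ + s_k)) ∏_{i ∈ T} (factor i)` of the
multisum, divided by `(q²; q²)_{s_1 - s_2} ⋯ (q²; q²)_{s_{k-1} - s_k}`. What remains of the summand
depends on `s_k` only and is given by a Bailey pair. -/
noncomputable def bggWeight (q : ℂ) (k r : ℕ) (T : Finset ℕ) (s : DecTuple k) : ℂ :=
  q ^ (2 * (∑ i ∈ Icc 1 k, s.entry i ^ 2 + ∑ i ∈ Icc (k - r + 1) k, s.entry i)) *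
    (∏ i ∈ T, bggFactor q s i) /
      ∏ i ∈ Icc 1 (k - 1), qPoch (q ^ 2) (q ^ 2) (s.entry i - s.entry (i + 1))

theorem DecTuple.entry_succ {k : ℕ} (s : DecTuple k) (i : Fin k) : s.entry (i + 1) = s.1 i :=
  dif_pos ⟨by lia, by lia⟩

theorem DecTuple.entry_anti {k : ℕ} (s : DecTuple (k + 1)) {i : ℕ} (hi : i < k) :
    s.entry (i + 2) ≤ s.entry (i + 1) := by
  rw [s.entry_succ ⟨i, by lia⟩, s.entry_succ ⟨i + 1, by lia⟩]
  exact s.2 (Fin.mk_le_mk.mpr i.le_succ)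

theorem pathTerm_decTuple {k : ℕ} (g : ℕ → ℕ → ℕ → ℂ) (β : ℕ → ℂ) (s : DecTuple (k + 1)) :
    pathTerm g β s.1 =
      (∏ i ∈ range k, g i (s.entry (i + 1)) (s.entry (i + 2))) * β (s.entry (k + 1)) := by
  have hlast : s.entry (k + 1) = s.1 (Fin.last k) := s.entry_succ (Fin.last k)
  have hleft (i : Fin k) : s.entry (i + 1) = s.1 i.castSucc := s.entry_succ i.castSucc
  have hright (i : Fin k) : s.entry (i + 2) = s.1 i.succ := s.entry_succ i.succ
  simp only [pathTerm, prod_range, hlast, hleft, hright]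

theorem bggFactor_one (q : ℂ) {k : ℕ} (s : DecTuple k) :
    bggFactor q s 1 = ((q ^ 2) ^ s.entry 1)⁻¹ := by
  rw [bggFactor, if_pos rfl, neg_mul, zpow_neg, ← pow_mul]
  norm_cast

theorem bggFactor_add_two (q : ℂ) {k : ℕ} (s : DecTuple k) (i : ℕ) :
    bggFactor q s (i + 2) =
      (q ^ 2) ^ s.entry (i + 1) + ((q ^ 2) ^ s.entry (i + 2))⁻¹ := by
  rw [bggFactor, if_neg (by lia), neg_mul, zpow_neg, ← pow_mul, ← pow_mul]
  norm_cast

theorem pow_two_mul_sum_entry (q : ℂ) {k r d : ℕ} (hk : k = d + r) (s : DecTuple k) :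
    q ^ (2 * (∑ i ∈ Icc 1 k, s.entry i ^ 2 + ∑ i ∈ Icc (k - r + 1) k, s.entry i)) =
      ∏ i ∈ range k, (q ^ 2) ^ (s.entry (i + 1) ^ 2) *
        if i < d then 1 else (q ^ 2) ^ s.entry (i + 1) := by
  have hIcc : Icc (k - r + 1) k = {i ∈ Icc 1 k | ¬ i ≤ d} := by
    ext i
    simp only [mem_Icc, mem_filter]
    lia
  rw [pow_mul, pow_add, ← prod_pow_eq_pow_sum, ← prod_pow_eq_pow_sum, hIcc, prod_filter,
    prod_Icc_one, prod_Icc_one, ← prod_mul_distrib]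
  simp only [ite_not, Nat.add_one_le_iff]

theorem inv_prod_qPoch_entry_sub (q : ℂ) {k : ℕ} (s : DecTuple (k + 1)) :
    (∏ i ∈ Icc 1 k, qPoch q q (s.entry i - s.entry (i + 1)))⁻¹ =
      ∏ i ∈ range k, invQPoch q (s.entry (i + 1) - s.entry (i + 2)) := by
  rw [prod_Icc_one, ← prod_inv_distrib]
  refine prod_congr rfl fun i hi ↦ ?_
  rw [← Nat.cast_sub (s.entry_anti (mem_range.mp hi)), invQPoch_natCast]

theorem bggWeight_mul_eq {q : ℂ} (hq : ‖q‖ < 1) {k r d : ℕ} (hk : k + 1 = d + r) {T : Finset ℕ}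
    (hT : T ⊆ Icc 1 d) (β : ℕ → ℂ) (s : DecTuple (k + 1)) :
    bggWeight q (k + 1) r T s * β (s.entry (k + 1)) = qPochInf (q ^ 2) (q ^ 2) *
      (bggKernelLim (q ^ 2) d T (s.1 0) *
        pathTerm (fun i ↦ bggKernel (q ^ 2) d T (i + 1)) β s.1) := by
  have hQ := norm_sq_lt_one hq
  have hT' : T ⊆ Icc 1 (k + 1) := hT.trans (Icc_subset_Icc_right (by lia))
  have hzero : s.1 0 = s.entry 1 := (s.entry_succ 0).symm
  have hinf := qPochInf_ne_zero hQ hQ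
  rw [bggWeight, pow_two_mul_sum_entry q hk, ← prod_range_ite_mem hT', div_eq_mul_inv,
    Nat.add_sub_cancel, inv_prod_qPoch_entry_sub, prod_range_succ', prod_range_succ', bggFactor_one,
    pathTerm_decTuple, hzero, bggKernelLim]
  simp only [bggFactor_add_two, bggKernel, prod_mul_distrib]
  field_simp

theorem hasSum_bggWeight_mul {q : ℂ} (hq0 : q ≠ 0) (hq : ‖q‖ < 1) {α : ℤ → ℂ} {β : ℕ → ℂ}
    (h : IsBaileyPair (q ^ 2) 0 α β) (hα : ∀ m, α (-1 - m) = -(q ^ 2) ^ (2 * m + 1) * α m)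
    {C : ℝ} (hβ : ∀ n, ‖β n‖ ≤ C) {k r d : ℕ} (hk1 : 1 ≤ k) (hk : k = d + r) {T : Finset ℕ}
    (hT : T ⊆ Icc 1 d) {A : ℂ}
    (hA : HasSum (fun m ↦ ((q ^ 2) ^ (m * m)) ^ d * ((q ^ 2) ^ m + (q ^ 2) ^ (-m)) ^ #T *
      (((q ^ 2) ^ (m * (m + 1))) ^ r * α m)) A) :
    HasSum (fun s : DecTuple k ↦ bggWeight q k r T s * β (s.entry k))
      (A / qPochInf (q ^ 2) (q ^ 2)) := by
  have hQ := norm_sq_lt_one hq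
  have hQ0 := pow_ne_zero 2 hq0
  have hinf := qPochInf_ne_zero hQ hQ
  obtain ⟨k, rfl⟩ := Nat.exists_eq_add_of_le' hk1
  obtain ⟨b, hb, hgb⟩ := exists_summable_norm_bggKernel_le hQ0 hQ d T
  have hlim := (isBaileyPair_pathSum_bggKernel hQ0 (qPoch_ne_zero hQ hQ) h hα hT r).tendsto hQ
    hA.summable
  rw [hA.tsum_eq, ← hk] at hlim
  have hpaths := (hasSum_pathTerm_of_tendsto (fun i x y ↦ bggKernel_of_lt (q ^ 2) d T i) hgb hb hβ
    (tendsto_bggKernel hQ d T) hlim).mul_left (qPochInf (q ^ 2) (q ^ 2))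
  rw [← Subtype.val_injective (p := fun s : Fin (k + 1) → ℕ ↦ Antitone s).hasSum_iff
    fun s hs ↦ ?_] at hpaths
  · rw [show qPochInf (q ^ 2) (q ^ 2) * (A / qPochInf (q ^ 2) (q ^ 2) ^ 2) =
      A / qPochInf (q ^ 2) (q ^ 2) by field_simp] at hpaths
    exact hpaths.congr_fun (bggWeight_mul_eq hq hk hT β)
  · rw [pathTerm_eq_zero_of_not_antitone (fun i x y ↦ bggKernel_of_lt (q ^ 2) d T (i + 1)) β
      (fun h ↦ hs ⟨⟨s, h⟩, rfl⟩), mul_zero, mul_zero]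

theorem qPochInf_div_qPoch_eq_mul_initialBeta {q : ℂ} (hq : ‖q‖ < 1) (n : ℕ) :
    qPochInf (-q ^ (1 + 2 * n)) (q ^ 2) / qPoch (q ^ 2) (q ^ 2) n =
      qPochInf (-q ^ 3) (q ^ 2) * initialBeta q n := by
  have hQ := norm_sq_lt_one hq
  have hne := qPoch_ne_zero hQ ((norm_neg q).trans_lt hq) n
  have hone := qPoch_mul_qPochInf (-q) hQ 1
  have hn := qPoch_mul_qPochInf (-q) hQ n
  rw [show -q * (q ^ 2) ^ 1 = -q ^ 3 by ring, qPoch_succ, qPoch_zero, one_mul, pow_zero, mul_one,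
    sub_neg_eq_add] at hone
  rw [show -q * (q ^ 2) ^ n = -q ^ (1 + 2 * n) by ring, ← hone] at hn
  rw [initialBeta, invQPoch_natCast, eq_div_of_mul_eq hne ((mul_comm _ _).trans hn)]
  ring

theorem bggTerm_eq {q : ℂ} (hq : ‖q‖ < 1) (k r : ℕ) (T : Finset ℕ) (s : DecTuple k) :
    bggTerm q k r T s =
      qPochInf (-q ^ 3) (q ^ 2) * (bggWeight q k r T s * initialBeta q (s.entry k)) := by
  rw [bggTerm, mul_div_mul_comm, qPochInf_div_qPoch_eq_mul_initialBeta hq, ← bggWeight,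
    mul_left_comm]

/-! ### The theta side -/

theorem hasSum_qPochInf3 {q : ℂ} (hq0 : q ≠ 0) (hq : ‖q‖ < 1) (k : ℕ) {a b c : ℤ}
    (ha : a = 2 * k + 2 + c) (hb : b = 2 * k + 2 - c) :
    HasSum (fun m : ℤ ↦ (-1) ^ m * q ^ ((2 * k + 2) * m ^ 2 - c * m))
      (qPochInf3 (q ^ (4 * k + 4)) (q ^ a) (q ^ b) (q ^ (4 * k + 4))) := by
  have hp : ‖q ^ (2 * k + 2)‖ < 1 := by
    rw [norm_pow]
    exact pow_lt_one₀ (norm_nonneg q) hq (by lia)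
  have hmul : q ^ c * q ^ (2 * k + 2) = q ^ a := by
    rw [← zpow_natCast q (2 * k + 2), ← zpow_add₀ hq0, ha]
    push_cast
    ring_nf
  have hdiv : q ^ (2 * k + 2) / q ^ c = q ^ b := by
    rw [← zpow_natCast q (2 * k + 2), ← zpow_sub₀ hq0, hb]
    push_cast
    ring_nf
  have h := (Equiv.neg ℤ).hasSum_iff.mpr
    (hasSum_jacobiTripleProduct (zpow_ne_zero c hq0) (pow_ne_zero (2 * k + 2) hq0) hp)
  rw [hmul, hdiv, ← pow_mul, show (2 * k + 2) * 2 = 4 * k + 4 by ring] at h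
  refine h.congr_fun fun m ↦ ?_
  have hexp : q ^ ((2 * k + 2) * m ^ 2 - c * m) = q ^ (c * -m) * (q ^ (2 * k + 2)) ^ (m ^ 2) := by
    rw [← zpow_natCast q (2 * k + 2), ← zpow_mul, ← zpow_add₀ hq0]
    push_cast
    ring_nf
  rw [Function.comp_apply, Equiv.neg_apply, neg_sq, neg_eq_neg_one_mul (q ^ c), mul_zpow, hexp,
    zpow_mul q c, zpow_neg (-1 : ℂ), ← inv_zpow, inv_neg, inv_one, mul_assoc]

theorem theta_weight_mul_initialAlpha_eq {q : ℂ} (hq0 : q ≠ 0) (r d j : ℕ) (m : ℤ) :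
    ((q ^ 2) ^ (m * m)) ^ d * ((q ^ 2) ^ m + (q ^ 2) ^ (-m)) ^ j *
        (((q ^ 2) ^ (m * (m + 1))) ^ r * initialAlpha q m) =
      ∑ s ∈ range (j + 1), (j.choose s : ℂ) *
        ((-1) ^ m * q ^ ((2 * (d + r : ℕ) + 2) * m ^ 2 - (1 - 2 * r + 2 * j - 4 * s) * m) +
          q * ((-1) ^ m *
            q ^ ((2 * (d + r : ℕ) + 2) * m ^ 2 - (-1 - 2 * r + 2 * j - 4 * s) * m))) := by
  rw [add_pow, mul_sum, sum_mul]
  refine sum_congr rfl fun s hs ↦ ?_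
  have hsj : s ≤ j := Nat.lt_succ_iff.mp (mem_range.mp hs)
  set e : ℤ := 2 * (d + r : ℕ) * m ^ 2 - (-2 * r + 2 * j - 4 * s) * m with he
  have hweight : ((q ^ 2) ^ (m * m)) ^ d * (((q ^ 2) ^ m) ^ s * ((q ^ 2) ^ (-m)) ^ (j - s)) *
      ((q ^ 2) ^ (m * (m + 1))) ^ r = q ^ e := by
    simp only [← zpow_natCast, ← zpow_mul, ← zpow_add₀ hq0]
    congr 1
    push_cast [he, Nat.cast_sub hsj]
    ring
  have hfst : q ^ ((2 * (d + r : ℕ) + 2) * m ^ 2 - (1 - 2 * r + 2 * j - 4 * s) * m) =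
      q ^ e * q ^ (2 * m ^ 2 - m) := by
    rw [he, ← zpow_add₀ hq0]
    ring_nf
  have hsnd : q * q ^ ((2 * (d + r : ℕ) + 2) * m ^ 2 - (-1 - 2 * r + 2 * j - 4 * s) * m) =
      q ^ e * q ^ (2 * m ^ 2 + m + 1) := by
    rw [he, ← zpow_one_add₀ hq0, ← zpow_add₀ hq0]
    ring_nf
  rw [mul_left_comm q, hfst, hsnd, ← hweight, initialAlpha]
  ring

theorem hasSum_bggTerm {q : ℂ} (hq0 : q ≠ 0) (hq : ‖q‖ < 1) {k r d : ℕ} (hk1 : 1 ≤ k)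
    (hk : k = d + r) {T : Finset ℕ} (hT : T ⊆ Icc 1 d) :
    HasSum (bggTerm q k r T) (bggProductSide q k r #T) := by
  have htheta := hasSum_sum (s := range (#T + 1)) fun s _ ↦
    ((hasSum_qPochInf3 hq0 hq k (c := 1 - 2 * r + 2 * #T - 4 * s)
      (a := 2 * k + 3 - 2 * r + 2 * #T - 4 * s) (b := 2 * k + 1 + 2 * r - 2 * #T + 4 * s)
      (by ring) (by ring)).add
    ((hasSum_qPochInf3 hq0 hq k (c := -1 - 2 * r + 2 * #T - 4 * s)
      (a := 2 * k + 1 - 2 * r + 2 * #T - 4 * s) (b := 2 * k + 3 + 2 * r - 2 * #T + 4 * s)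
      (by ring) (by ring)).mul_left q)).mul_left ((#T).choose s : ℂ)
  have hmultisum := (hasSum_bggWeight_mul hq0 hq (isBaileyPair_initial hq0 hq)
    (initialAlpha_antisymm hq0) (exists_norm_initialBeta_le hq).choose_spec hk1 hk hT
    (htheta.congr_fun fun m ↦ hk ▸ theta_weight_mul_initialAlpha_eq hq0 r d #T m)).mul_left
      (qPochInf (-q ^ 3) (q ^ 2))
  rw [bggProductSide, div_mul_eq_mul_div, mul_div_assoc]
  exact hmultisum.congr_fun (bggTerm_eq hq k r T)

theorem mainTheorem4 (q : ℂ) (hq0 : q ≠ 0) (hq1 : ‖q‖ < 1)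
    (j r k : ℕ) (hk : 1 ≤ k) (hjr : j + r ≤ k) :
    HasSum (bggTerm q k r (Finset.Icc 1 j)) (bggProductSide q k r j) ∧
    ∀ T : Finset ℕ, T ⊆ {1} ∪ Finset.Icc 2 (k - r) → T.card = j →
      HasSum (bggTerm q k r T) (bggProductSide q k r j) := by
  have hsubset {T : Finset ℕ} (hT : T ⊆ Icc 1 (k - r)) (hj : #T = j) :
      HasSum (bggTerm q k r T) (bggProductSide q k r j) :=
    hj ▸ hasSum_bggTerm hq0 hq1 hk (by lia) hT
  refine ⟨hsubset (Icc_subset_Icc_right (by lia)) (by simp), fun T hT hj ↦ hsubset ?_ hj⟩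
  intro i hi
  have hcard : 0 < #T := card_pos.mpr ⟨i, hi⟩
  have hi' := hT hi
  simp only [mem_union, mem_singleton, mem_Icc] at hi' ⊢
  lia
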